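/- Let $n\ge 0$ be an integer. A real $n\times n$ matrix is \emph{totally nonnegative} if all its minors are nonnegative. Let $I$ be the $n\times n$ identity matrix and $E_{i,j}$ the $n\times n$ matrix whose $(i,j)$-entry is $1$ and whose other entries are $0$. For real $t$ put $$x_i(t)=I+tE_{i,i+1},\qquad x_{\bar i}(t)=I+tE_{i+1,i}\qquad(1\le i\le n-1),$$ $$x_{(i)}(t)=I+(t-1)E_{i,i}\qquad(1\le i\le n),$$ where $(i)$ denotes the "circled" letter $i$. For a word $\mathbf i=(i_1,\dots,i_l)$ in the alphabet $\{1,\dots,n-1,(1),\dots,(n),\bar 1,\dots,\overline{n-1}\}$ put $$x_{\mathbf i}(t_1,\dots,t_l)=x_{i_1}(t_1)\cdots x_{i_l}(t_l).$$ Let $\mathbf i_{\max}$ be the word of length $n^2$ obtained by concatenating the blocks $\bar k,\overline{k+1},\dots,\overline{n-1}$ for $k=n-1,n-2,\dots,1$ (in this order), then the letters $(1),(2),\dots,(n)$, then the blocks $k,k+1,\dots,n-1$ for $k=n-1,n-2,\dots,1$ (in this order). For example, for $n=4$, $$\mathbf i_{\max}=(\bar3,\bar2,\bar3,\bar1,\bar2,\bar3,(1),(2),(3),(4),3,2,3,1,2,3).$$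 An \emph{elementary Jacobi matrix} is an invertible $n\times n$ matrix that differs from $I$ in a single entry, located on the main diagonal or immediately above or below it. \textbf{Theorem.} Let $x$ be an invertible totally nonnegative real $n\times n$ matrix. Then: 1. There are real numbers $t_1,\dots,t_{n^2}\ge 0$ with $x=x_{\mathbf i_{\max}}(t_1,\dots,t_{n^2})$, where moreover $t_k>0$ for every $k$ for which the $k$-th letter of $\mathbf i_{\max}$ is one of the circled letters $(1),\dots,(n)$. 2. (Loewner–Whitney theorem) $x$ is a (possibly empty) product of elementary Jacobi matrices with nonnegative entries. -/

import Mathlib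

/-- A real square matrix is totally nonnegative if all its minors are nonnegative: `r` and `c`
list the rows and columns of the minor in increasing order. -/
def IsTotallyNonneg {n : ℕ} (A : Matrix (Fin n) (Fin n) ℝ) : Prop :=
  ∀ (k : ℕ) (r c : Fin k ↪o Fin n), 0 ≤ (A.submatrix r c).det

/-- An elementary Jacobi matrix: an invertible matrix that differs from the identity matrix in
a single entry, located on the main diagonal or immediately above or below it. -/
def IsElementaryJacobi {n : ℕ} (M : Matrix (Fin n) (Fin n) ℝ) : Prop :=
  IsUnit M ∧ ∃ i j : Fin n,
    (i = j ∨ (i : ℕ) + 1 = j ∨ (j : ℕ) + 1 = i) ∧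
    M i j ≠ (1 : Matrix (Fin n) (Fin n) ℝ) i j ∧
    ∀ a b : Fin n, (a, b) ≠ (i, j) → M a b = (1 : Matrix (Fin n) (Fin n) ℝ) a b

/-- The alphabet `{1, …, n-1, ①, …, ⓝ, 1̄, …, (n-1)̄}`. Indices start at `0` here, so
`upper i`, `circled i`, `lower i` stand for the letters with number `i + 1`. -/
inductive JacobiLetter (n : ℕ) : Type
  | upper (i : Fin (n - 1))
  | circled (i : Fin n)
  | lower (i : Fin (n - 1))

/-- The matrices attached to the letters: `I + t E_{i,i+1}`, `I + (t - 1) E_{i,i}` and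
`I + t E_{i+1,i}`. -/
def JacobiLetter.toMatrix {n : ℕ} (a : JacobiLetter n) (t : ℝ) : Matrix (Fin n) (Fin n) ℝ :=
  match a with
  | .upper i => 1 + Matrix.single ⟨i, by omega⟩ ⟨i + 1, by omega⟩ t
  | .circled i => 1 + Matrix.single i i (t - 1)
  | .lower i => 1 + Matrix.single ⟨i + 1, by omega⟩ ⟨i, by omega⟩ t

/-- The product map `x_w(t₁, …, t_l) = x_{w₁}(t₁) ⋯ x_{w_l}(t_l)` of a word `w` of length `l`. -/
def jacobiProduct {n l : ℕ} (w : Fin l → JacobiLetter n) (t : Fin l → ℝ) :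
    Matrix (Fin n) (Fin n) ℝ :=
  (List.ofFn fun k => (w k).toMatrix (t k)).prod

/-- For `m = n - 1`, with letters numbered from `1`, the word
`m; m-1, m; m-2, m-1, m; …; 1, 2, …, m`. -/
def staircaseWord (m : ℕ) : List (Fin m) :=
  (List.finRange m).reverse.flatMap fun k => (List.finRange m).filter fun i => k ≤ i

/-- The word `i_max` as a list: the barred staircase word, then `①, …, ⓝ`, then the unbarred
staircase word. -/
def iMaxList (n : ℕ) : List (JacobiLetter n) :=
  (staircaseWord (n - 1)).map .lower ++ (List.finRange n).map .circled ++
    (staircaseWord (n - 1)).map .upper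

theorem length_staircaseWord (m : ℕ) : 2 * (staircaseWord m).length = m * (m + 1) := by
  have h : ∀ k : Fin m, ((List.finRange m).filter fun i => k ≤ i).length = m - k := by
    intro k
    have h1 : ((Finset.univ : Finset (Fin m)).filter fun i => k ≤ i).card = m - k := by
      have : ((Finset.univ : Finset (Fin m)).filter fun i => k ≤ i) = Finset.Ici k := by
        ext; simp
      rw [this, Fin.card_Ici]
    rw [← h1, ← List.toFinset_card_of_nodup ((List.nodup_finRange m).filter _)]
    congr 1
    ext; simp
  have h2 : (staircaseWord m).length = ∑ k : Fin m, (m - (k : ℕ)) := by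
    simp only [staircaseWord, List.length_flatMap, h, List.map_reverse, List.sum_reverse]
    rw [← List.ofFn_eq_map, List.sum_ofFn]
  rw [h2, Fin.sum_univ_eq_sum_range (fun k => m - k) m]
  clear h h2
  induction m with
  | zero => simp
  | succ m ih =>
    rw [Finset.sum_range_succ', mul_add]
    simp only [Nat.add_sub_add_right, ih]
    simp
    ring

theorem length_iMaxList (n : ℕ) : (iMaxList n).length = n ^ 2 := by
  have h := length_staircaseWord (n - 1)
  simp only [iMaxList, List.length_append, List.length_map, List.length_finRange]
  rcases n with _ | n
  · simp at h ⊢; omega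
  · simp only [Nat.add_sub_cancel] at h ⊢
    nlinarith

/-- The word `i_max` of length `n²`. -/
def iMax (n : ℕ) (k : Fin (n ^ 2)) : JacobiLetter n :=
  (iMaxList n).get (k.cast (length_iMaxList n).symm)

/-!
The factorization is Neville elimination: a totally nonnegative invertible matrix is reduced to
diagonal form by subtracting from a row (or column) a multiple of the adjacent one, and every
intermediate matrix is again totally nonnegative, so that all parameters are nonnegative.

The entries of the first column are killed from the bottom up. Let `i` and `j = i + 1` be the
rows in play, with the first column already zero below row `j`. If `A i 0 = 0`, then `A j 0 = 0`
(`IsTotallyNonneg.eq_zero_of_eq_zero`) and nothing is to be done. Otherwise the minors affected by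
subtracting `A j 0 / A i 0` times row `i` from row `j` are those that use row `j` but not row `i`,
and they stay nonnegative because exchanging `i` for `j` in a minor multiplies it by at least
`A j 0 / A i 0` (`IsTotallyNonneg.minor_exchange_le`). This inequality is an induction on the number
of rows above `i` in the minor: with no such row it is the Laplace expansion of a larger minor
along the first column, and the three-term relation `plucker_three_term` removes one such row.

Eliminating the first column and then, by transposition, the first row leaves a block diagonal
matrix `consBlock a S` with `a > 0`. By induction `S` is a product along the word `i_max` of size
one less, with the letter numbers shifted by one. In the upper factor the new letters `1, …, n`
complete the staircase word directly; in the lower factor the letters `n, …, 1` come first and are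
moved to their places past letters they commute with (`IsWordProduct.staircase_lower`). Dropping
the factors equal to the identity gives the Loewner–Whitney theorem.
-/

/-! ### Minors of totally nonnegative matrices -/

theorem IsTotallyNonneg.det_submatrix_nonneg {n k : ℕ} {A : Matrix (Fin n) (Fin n) ℝ}
    (hA : IsTotallyNonneg A) {r c : Fin k → Fin n} (hr : StrictMono r) (hc : StrictMono c) :
    0 ≤ (A.submatrix r c).det :=
  hA k (OrderEmbedding.ofStrictMono r hr) (OrderEmbedding.ofStrictMono c hc)

theorem IsTotallyNonneg.entry_nonneg {n : ℕ} {A : Matrix (Fin n) (Fin n) ℝ}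
    (hA : IsTotallyNonneg A) (i j : Fin n) : 0 ≤ A i j := by
  simpa using hA.det_submatrix_nonneg (r := fun _ : Fin 1 => i) (c := fun _ => j)
    (Subsingleton.strictMono _) (Subsingleton.strictMono _)

theorem IsTotallyNonneg.transpose {n : ℕ} {A : Matrix (Fin n) (Fin n) ℝ}
    (hA : IsTotallyNonneg A) : IsTotallyNonneg A.transpose := fun k r c => by
  have := hA k c r
  rwa [← Matrix.det_transpose, Matrix.transpose_submatrix] at this

theorem IsTotallyNonneg.submatrix {n m : ℕ} {A : Matrix (Fin n) (Fin n) ℝ}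
    (hA : IsTotallyNonneg A) {r c : Fin m → Fin n} (hr : StrictMono r) (hc : StrictMono c) :
    IsTotallyNonneg (A.submatrix r c) := fun k r' c' => by
  rw [Matrix.submatrix_submatrix]
  exact hA.det_submatrix_nonneg (hr.comp r'.strictMono) (hc.comp c'.strictMono)

/-! ### A three-term Plücker relation -/

/-- The list of row positions left after deleting positions `p + 1` and `p + 2`. -/
def skipTwo {k : ℕ} (p : Fin (k + 1)) : Fin (k + 1) → Fin (k + 3) :=
  p.succ.succ.succAbove ∘ p.succ.succAbove

theorem update_skipTwo_self {k : ℕ} (p : Fin (k + 1)) :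
    Function.update (skipTwo p) p p.castSucc.castSucc = skipTwo p := by
  rw [Function.update_eq_self_iff]
  simp [skipTwo, Fin.succAbove, Fin.lt_def]

theorem update_skipTwo_succ {k : ℕ} (p : Fin (k + 1)) :
    Function.update (skipTwo p) p p.succ.castSucc =
      p.castSucc.castSucc.succAbove ∘ p.succ.succAbove := by
  funext x
  by_cases h : x = p
  · subst h
    simp [Fin.succAbove, Fin.lt_def]
  · rw [Function.update_of_ne h]
    have h' : (x : ℕ) ≠ p := fun e => h (Fin.ext e)
    simp only [skipTwo, Fin.succAbove, Fin.ext_iff, Fin.lt_def, Function.comp]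
    split_ifs <;> simp_all <;> omega

theorem update_skipTwo_succ_succ {k : ℕ} (p : Fin (k + 1)) :
    Function.update (skipTwo p) p p.succ.succ =
      p.castSucc.castSucc.succAbove ∘ p.castSucc.succAbove := by
  funext x
  by_cases h : x = p
  · subst h
    simp [Fin.succAbove, Fin.lt_def]
  · rw [Function.update_of_ne h]
    have h' : (x : ℕ) ≠ p := fun e => h (Fin.ext e)
    simp only [skipTwo, Fin.succAbove, Fin.ext_iff, Fin.lt_def, Function.comp]
    split_ifs <;> simp_all <;> omega

theorem exists_skipTwo_eq {k : ℕ} (p : Fin (k + 1)) (x : Fin (k + 3))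
    (ha : x ≠ p.castSucc.castSucc) (hb : x ≠ p.succ.castSucc) (hd : x ≠ p.succ.succ) :
    ∃ y, y ≠ p ∧ skipTwo p y = x := by
  obtain ⟨z, rfl⟩ := Fin.exists_succAbove_eq hd
  have hz : z ≠ p.succ := by
    rintro rfl
    apply hb
    simp [Fin.succAbove, Fin.lt_def]
  obtain ⟨y, rfl⟩ := Fin.exists_succAbove_eq hz
  refine ⟨y, ?_, rfl⟩
  rintro rfl
  apply ha
  simp [Fin.succAbove, Fin.lt_def]

/-- Three-term Plücker relation between the maximal minors of a `(k + 3) × (k + 2)` matrix and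
those of the matrix with column `e` deleted. Appending the column `x ↦ φ x`, where `φ x` is the
smaller minor with its row at position `p` replaced by row `x`, gives a singular square matrix,
since `φ` is linear in that row; its expansion along the new column has only three nonzero
terms. -/
theorem plucker_three_term {k : ℕ} (B : Matrix (Fin (k + 3)) (Fin (k + 2)) ℝ)
    (e : Fin (k + 2)) (p : Fin (k + 1)) :
    (B.submatrix (p.castSucc.castSucc.succAbove ∘ p.succ.succAbove) e.succAbove).det *
        (B.submatrix p.succ.castSucc.succAbove id).det =
      (B.submatrix (skipTwo p) e.succAbove).det *
        (B.submatrix p.castSucc.castSucc.succAbove id).det +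
      (B.submatrix (p.castSucc.castSucc.succAbove ∘ p.castSucc.succAbove) e.succAbove).det *
        (B.submatrix p.succ.succ.succAbove id).det := by
  set φ : Fin (k + 3) → ℝ := fun x =>
    (B.submatrix (Function.update (skipTwo p) p x) e.succAbove).det with hφ
  obtain ⟨w, hw⟩ : ∃ w : Fin (k + 1) → ℝ, ∀ x, φ x = ∑ y, B x (e.succAbove y) * w y := by
    set N := B.submatrix (skipTwo p) e.succAbove with hN
    refine ⟨fun y => N.transpose.adjugate p y, fun x => ?_⟩
    have : B.submatrix (Function.update (skipTwo p) p x) e.succAbove =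
        N.updateRow p (fun y => B x (e.succAbove y)) := by
      ext i j
      by_cases h : i = p
      · subst h; simp
      · simp [h, hN]
    rw [hφ]
    simp only
    rw [this, ← Matrix.cramer_transpose_apply, Matrix.cramer_eq_adjugate_mulVec]
    simp [Matrix.mulVec, dotProduct, mul_comm]
  -- `B` with the column `φ` prepended; the coefficients `w` give a vector in its kernel.
  let M : Matrix (Fin (k + 3)) (Fin (k + 3)) ℝ :=
    Matrix.of fun x => Fin.cons (φ x) (B x)
  have hM : M.det = 0 := by
    rw [← Matrix.exists_mulVec_eq_zero_iff]
    refine ⟨Fin.cons 1 (e.insertNth 0 fun y => - w y), fun h => ?_, ?_⟩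
    · simpa using congrFun h 0
    · funext x
      simp [Matrix.mulVec, dotProduct, Fin.sum_univ_succ (n := k + 2), M,
        Fin.sum_univ_succAbove _ e, hw]
  have hsub : ∀ x : Fin (k + 3), M.submatrix x.succAbove Fin.succ = B.submatrix x.succAbove id := by
    intro x; ext i j; simp [M]
  have hM0 : ∀ x, M x 0 = φ x := fun x => by simp [M]
  rw [Matrix.det_succ_column_zero] at hM
  have hz : ∀ x : Fin (k + 3), x ≠ p.castSucc.castSucc → x ≠ p.succ.castSucc →
      x ≠ p.succ.succ → φ x = 0 := by
    intro x ha hb hd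
    obtain ⟨y, hy, rfl⟩ := exists_skipTwo_eq p x ha hb hd
    apply Matrix.det_zero_of_row_eq hy
    funext j
    simp [hy]
  have hab : (p.castSucc.castSucc : Fin (k + 3)) ≠ p.succ.castSucc := by simp [Fin.ext_iff]
  have had : (p.castSucc.castSucc : Fin (k + 3)) ≠ p.succ.succ := by
    simp [Fin.ext_iff]; omega
  have hbd : (p.succ.castSucc : Fin (k + 3)) ≠ p.succ.succ := by simp [Fin.ext_iff]
  rw [← Finset.sum_subset (Finset.subset_univ {p.castSucc.castSucc, p.succ.castSucc, p.succ.succ})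
    (by
      intro x _ hx
      simp only [Finset.mem_insert, Finset.mem_singleton, not_or] at hx
      rw [hM0, hz x hx.1 hx.2.1 hx.2.2]; simp),
    Finset.sum_insert (by rw [Finset.mem_insert, Finset.mem_singleton]; tauto),
    Finset.sum_insert (by rwa [Finset.mem_singleton]),
    Finset.sum_singleton] at hM
  simp only [hM0, hsub, hφ, update_skipTwo_self, update_skipTwo_succ, update_skipTwo_succ_succ,
    Fin.val_castSucc, Fin.val_succ, pow_succ] at hM
  have h1 : ((-1 : ℝ) ^ (p : ℕ)) ≠ 0 := by positivity
  apply mul_left_cancel₀ h1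
  linarith

/-! ### Exchanging adjacent rows in a minor -/

/-- If the first column of `A` vanishes below row `j`, the ratio of the entries of that column in
the consecutive rows `i` and `j` is a lower bound for the ratio of any two minors that differ by
exchanging row `i` for row `j`. The rows `s` contain both `i` and `j`, at positions `p` and
`p + 1`, and each minor omits one of them. -/
theorem IsTotallyNonneg.minor_exchange_le {n : ℕ} {A : Matrix (Fin (n + 1)) (Fin (n + 1)) ℝ}
    (hA : IsTotallyNonneg A) {i j : Fin (n + 1)} (hz : ∀ l, j < l → A l 0 = 0) (p : ℕ) :
    ∀ {k : ℕ} {s : Fin (k + 2) → Fin (n + 1)} {c : Fin (k + 1) → Fin (n + 1)},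
      StrictMono s → StrictMono c → ∀ hp : p < k + 1,
      s ⟨p, by omega⟩ = i → s ⟨p + 1, by omega⟩ = j →
      A j 0 * (A.submatrix (s ∘ Fin.succAbove ⟨p + 1, by omega⟩) c).det ≤
        A i 0 * (A.submatrix (s ∘ Fin.succAbove ⟨p, by omega⟩) c).det := by
  induction p with
  | zero =>
    intro k s c hs hc hp hi hj
    have hi' : s 0 = i := hi
    have hj' : s 1 = j := hj
    have hl : ∀ l : Fin k, A (s l.succ.succ) 0 = 0 := fun l => by
      apply hz
      rw [← hj']
      apply hs
      simp [Fin.lt_def]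
    change A j 0 * (A.submatrix (s ∘ Fin.succAbove 1) c).det ≤
      A i 0 * (A.submatrix (s ∘ Fin.succAbove 0) c).det
    by_cases h0 : c 0 = 0
    · -- Both minors are multiples of the same minor of rows below `j`.
      have e1 : ((1 : Fin (k + 2)).succAbove ∘ (0 : Fin (k + 1)).succAbove) =
          (0 : Fin (k + 2)).succAbove ∘ (0 : Fin (k + 1)).succAbove := by
        funext x
        simp [Fin.succAbove, Fin.lt_def]
      have e2 : ∀ x : Fin k, (1 : Fin (k + 2)).succAbove x.succ = x.succ.succ := fun x => by
        simp [Fin.succAbove, Fin.lt_def]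
      rw [Matrix.det_succ_column_zero, Matrix.det_succ_column_zero, Fin.sum_univ_succ,
        Fin.sum_univ_succ, Finset.sum_eq_zero, Finset.sum_eq_zero]
      · simp only [Matrix.submatrix_apply, h0, Matrix.submatrix_submatrix, Function.comp_assoc, e1]
        simp [hi', hj']
        apply le_of_eq
        ring
      · intro x _
        simp [h0, hl]
      · intro x _
        simp [h0, e2, hl]
    · -- Expand the minor with column `0` added along that column.
      have hc' : StrictMono (Fin.cons 0 c : Fin (k + 2) → Fin (n + 1)) := by
        rw [Fin.strictMono_iff_lt_succ]
        intro x
        refine Fin.cases ?_ (fun x => ?_) x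
        · simpa using Fin.pos_iff_ne_zero.2 h0
        · have : x.succ.castSucc = x.castSucc.succ := rfl
          rw [this]
          simpa using hc (Fin.castSucc_lt_succ)
      have := hA.det_submatrix_nonneg hs hc'
      rw [Matrix.det_succ_column_zero, Fin.sum_univ_succ, Fin.sum_univ_succ,
        Finset.sum_eq_zero] at this
      · simp only [Matrix.submatrix_submatrix] at this
        have e : (Fin.cons 0 c : Fin (k + 2) → Fin (n + 1)) ∘ Fin.succ = c := by
          funext x; simp
        rw [e] at this
        simp [hi', hj'] at this
        simp
        linarith
      · intro x _
        simp [hl]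
  | succ p ih =>
    -- The row at position `q = p`, just above `i`, is the one to be removed.
    intro k s c hs hc hp hi hj
    obtain ⟨k, rfl⟩ : ∃ k', k = k' + 1 := ⟨k - 1, by omega⟩
    set q : Fin (k + 1) := ⟨p, by omega⟩ with hq
    have hb : (⟨p + 1, by omega⟩ : Fin (k + 3)) = q.succ.castSucc := rfl
    have hd : (⟨p + 1 + 1, by omega⟩ : Fin (k + 3)) = q.succ.succ := rfl
    simp only [hb, hd] at hi hj ⊢
    have hsm : ∀ {m : ℕ} (x : Fin (m + 1)), StrictMono x.succAbove :=
      fun x => Fin.strictMono_succAbove x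
    have hFb := hA.det_submatrix_nonneg (hs.comp (hsm q.succ.castSucc)) hc
    have hFa := hA.det_submatrix_nonneg (hs.comp (hsm q.castSucc.castSucc)) hc
    have hFd := hA.det_submatrix_nonneg (hs.comp (hsm q.succ.succ)) hc
    -- If all smaller minors with row `i` vanish, so does the minor with row `i`. Otherwise divide
    -- by one of them.
    by_cases hall : ∀ e : Fin (k + 2), (A.submatrix
        (s ∘ q.castSucc.castSucc.succAbove ∘ q.succ.succAbove) (c ∘ e.succAbove)).det = 0
    · have h0 : (A.submatrix (s ∘ q.succ.succ.succAbove) c).det = 0 := by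
        rw [Matrix.det_succ_row _ q.castSucc]
        refine Finset.sum_eq_zero fun e _ => ?_
        rw [Matrix.submatrix_submatrix]
        have : q.succ.succ.succAbove ∘ q.castSucc.succAbove =
            q.castSucc.castSucc.succAbove ∘ q.succ.succAbove := by
          funext x
          simp only [Fin.succAbove, Fin.ext_iff, Fin.lt_def, Function.comp]
          split_ifs <;> simp_all <;> omega
        rw [Function.comp_assoc, this, hall, mul_zero]
      rw [h0, mul_zero]
      exact mul_nonneg (hA.entry_nonneg _ _) hFb
    · push Not at hall
      obtain ⟨e, he⟩ := hall
      have hpos := lt_of_le_of_ne (hA.det_submatrix_nonneg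
        (hs.comp ((hsm q.castSucc.castSucc).comp (hsm q.succ))) (hc.comp (hsm e))) he.symm
      have hpl := plucker_three_term (A.submatrix s c) e q
      simp only [Matrix.submatrix_submatrix, Function.comp_id] at hpl
      have hpa := hA.det_submatrix_nonneg
        (hs.comp (show StrictMono (skipTwo q) from (hsm q.succ.succ).comp (hsm q.succ)))
        (hc.comp (hsm e))
      have hih := ih (k := k) (s := s ∘ q.castSucc.castSucc.succAbove) (c := c ∘ e.succAbove)
        (hs.comp (hsm _)) (hc.comp (hsm e)) (by omega)
        (by rw [← hi]; simp [Fin.succAbove, hq])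
        (by rw [← hj]; simp [Fin.succAbove, Fin.lt_def, hq])
      have hb' : (⟨p + 1, by omega⟩ : Fin (k + 2)) = q.succ := rfl
      have ha' : (⟨p, by omega⟩ : Fin (k + 2)) = q.castSucc := rfl
      rw [hb', ha'] at hih
      simp only [Function.comp_assoc] at hih
      refine le_of_mul_le_mul_left ?_ hpos
      have h1 := mul_le_mul_of_nonneg_right hih hFd
      have h2 := mul_nonneg (hA.entry_nonneg i 0) (mul_nonneg hpa hFa)
      have h3 := congrArg (A i 0 * ·) hpl
      simp only [mul_add] at h3
      linarith

/-! ### Neville elimination of one entry -/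

theorem insertNth_strictMono_of_exchange {n k : ℕ} {r : Fin (k + 1) → Fin n} (hr : StrictMono r)
    {p : Fin (k + 1)} {i : Fin n} (hij : (i : ℕ) + 1 = r p) (hi : ∀ x, r x ≠ i) :
    StrictMono (p.castSucc.insertNth i r : Fin (k + 2) → Fin n) := by
  rw [Fin.strictMono_insertNth_iff]
  refine ⟨hr, fun x hx => ?_, fun x hx => ?_⟩
  · have h1 : x < p := hx
    have h2 : (r x : ℕ) < r p := hr h1
    have h3 : (r x : ℕ) ≠ i := fun h => hi x (Fin.ext h)
    rw [Fin.lt_def]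
    omega
  · have h1 : p ≤ x := hx
    have h2 : (r p : ℕ) ≤ r x := hr.monotone h1
    rw [Fin.lt_def]
    omega

theorem insertNth_comp_succAbove_succ {α : Type*} {k : ℕ} (r : Fin (k + 1) → α) (p : Fin (k + 1))
    (i : α) : (p.castSucc.insertNth i r : Fin (k + 2) → α) ∘ p.succ.succAbove =
      Function.update r p i := by
  funext x
  rcases eq_or_ne x p with rfl | h
  · rw [Function.comp_apply, Fin.succAbove_succ_self]
    simp
  · have : p.succ.succAbove x = p.castSucc.succAbove x := by
      have h' : (x : ℕ) ≠ p := fun e => h (Fin.ext e)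
      simp only [Fin.succAbove, Fin.ext_iff, Fin.lt_def]
      split_ifs <;> simp_all <;> omega
    rw [Function.comp_apply, this, Function.update_of_ne h]
    simp

/-- Subtracting from row `j` the multiple of the preceding row `i` that kills the entry of row
`j` in the first column preserves total nonnegativity, provided that column vanishes below
row `j`. -/
theorem IsTotallyNonneg.updateRow_sub {n : ℕ} {A : Matrix (Fin (n + 1)) (Fin (n + 1)) ℝ}
    (hA : IsTotallyNonneg A) {i j : Fin (n + 1)} (hij : (i : ℕ) + 1 = j)
    (hz : ∀ l, j < l → A l 0 = 0) (hi : 0 < A i 0) :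
    IsTotallyNonneg (A.updateRow j (A j + (-(A j 0 / A i 0)) • A i)) := by
  intro k r c
  have hne : j ≠ i := by rintro rfl; omega
  by_cases hj : ∃ p, r p = j
  · obtain ⟨p, hp⟩ := hj
    have hsub : (A.updateRow j (A j + (-(A j 0 / A i 0)) • A i)).submatrix r c =
        (A.submatrix r c).updateRow p
          ((A.submatrix r c) p + (-(A j 0 / A i 0)) • fun y => A i (c y)) := by
      ext x y
      by_cases hx : x = p
      · subst hx; simp [hp]
      · have : r x ≠ j := fun h => hx (r.injective (h.trans hp.symm))
        simp [this, hx]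
    rw [hsub]
    -- A minor that uses both rows does not change.
    by_cases hi' : ∃ q, r q = i
    · obtain ⟨q, hq⟩ := hi'
      have hpq : p ≠ q := by rintro rfl; exact hne (hp.symm.trans hq)
      have : (fun y => A i (c y)) = (A.submatrix r c) q := by
        funext y; simp [hq]
      rw [this, Matrix.det_updateRow_add_smul_self _ hpq]
      exact hA k r c
    · push Not at hi'
      rw [Matrix.det_updateRow_add, Matrix.updateRow_eq_self, Matrix.det_updateRow_smul]
      -- Insert `i` just before `j`: omitting `i` or `j` gives the two minors to be compared.
      obtain ⟨k, rfl⟩ : ∃ k', k = k' + 1 := ⟨k - 1, by have := p.pos; omega⟩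
      have hs := insertNth_strictMono_of_exchange r.strictMono (p := p) (i := i)
        (by rw [hij, hp]) hi'
      have key := hA.minor_exchange_le (i := i) hz p hs c.strictMono p.isLt
        (Fin.insertNth_apply_same p.castSucc (α := fun _ => Fin (n + 1)) i r) (by
          change p.castSucc.insertNth (α := fun _ => Fin (n + 1)) i r p.succ = j
          rw [← hp, ← Fin.succAbove_castSucc_self, Fin.insertNth_apply_succAbove])
      have e1 : (p.castSucc.insertNth i r : Fin (k + 2) → Fin (n + 1)) ∘
          Fin.succAbove ⟨p, by omega⟩ = r := by
        funext x
        exact Fin.insertNth_apply_succAbove (α := fun _ => Fin (n + 1)) p.castSucc i r x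
      have e2 : (p.castSucc.insertNth i r : Fin (k + 2) → Fin (n + 1)) ∘
          Fin.succAbove ⟨p + 1, by omega⟩ = Function.update r p i :=
        insertNth_comp_succAbove_succ r p i
      rw [e1, e2] at key
      have e3 : (A.submatrix r c).updateRow p (fun y => A i (c y)) =
          A.submatrix (Function.update r p i) c := by
        ext x y
        by_cases hx : x = p
        · subst hx; simp
        · simp [hx]
      rw [e3]
      have : A j 0 / A i 0 * (A.submatrix (Function.update r p i) c).det ≤
          (A.submatrix r c).det := by
        rw [div_mul_eq_mul_div, div_le_iff₀ hi]
        linarith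
      linarith
  · push Not at hj
    have : (A.updateRow j (A j + (-(A j 0 / A i 0)) • A i)).submatrix r c = A.submatrix r c := by
      ext x y
      simp [hj x]
    rw [this]
    exact hA k r c

/-- In the first column of an invertible totally nonnegative matrix, a zero entry is followed by a
zero entry: otherwise the `2 × 2` minors of the two rows force the upper row to vanish. -/
theorem IsTotallyNonneg.eq_zero_of_eq_zero {n : ℕ} {A : Matrix (Fin (n + 1)) (Fin (n + 1)) ℝ}
    (hA : IsTotallyNonneg A) (hu : IsUnit A) {i j : Fin (n + 1)} (hij : i < j)
    (hi : A i 0 = 0) : A j 0 = 0 := by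
  by_contra hj
  have hj' := lt_of_le_of_ne (hA.entry_nonneg j 0) (Ne.symm hj)
  have hrow : ∀ y, A i y = 0 := by
    intro y
    rcases eq_or_ne y 0 with rfl | hy
    · exact hi
    have := hA.det_submatrix_nonneg (r := ![i, j]) (c := ![0, y])
      (by rw [Fin.strictMono_iff_lt_succ]; intro x; fin_cases x; simpa using hij)
      (by rw [Fin.strictMono_iff_lt_succ]; intro x; fin_cases x
          simpa using Fin.pos_iff_ne_zero.2 hy)
    rw [Matrix.det_fin_two] at this
    simp [hi] at this
    have h2 := hA.entry_nonneg i y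
    by_contra h
    have := mul_pos (lt_of_le_of_ne h2 (Ne.symm h)) hj'
    linarith
  have := (Matrix.isUnit_iff_isUnit_det A).1 hu
  rw [Matrix.det_eq_zero_of_row_eq_zero i hrow] at this
  simp at this

/-! ### The matrices of the letters -/

theorem toMatrix_lower_mul {n : ℕ} (i : Fin n) (t : ℝ) (A : Matrix (Fin (n + 1)) (Fin (n + 1)) ℝ) :
    (JacobiLetter.lower (n := n + 1) i).toMatrix t * A =
      A.updateRow i.succ (A i.succ + t • A i.castSucc) := by
  have : (JacobiLetter.lower (n := n + 1) i).toMatrix t =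
      Matrix.transvection i.succ i.castSucc t := rfl
  rw [this]
  ext x y
  by_cases hx : x = i.succ
  · subst hx; simp
  · simp [hx]

theorem toMatrix_upper_transpose {n : ℕ} (i : Fin (n - 1)) (t : ℝ) :
    ((JacobiLetter.upper i).toMatrix t).transpose = (JacobiLetter.lower i).toMatrix t := by
  simp [JacobiLetter.toMatrix, Matrix.transpose_add]

theorem isUnit_toMatrix_lower {n : ℕ} (i : Fin (n - 1)) (t : ℝ) :
    IsUnit ((JacobiLetter.lower i).toMatrix t) := by
  rw [Matrix.isUnit_iff_isUnit_det]
  have h : (JacobiLetter.lower i).toMatrix t =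
      Matrix.transvection (⟨i + 1, by omega⟩ : Fin n) ⟨i, by omega⟩ t := rfl
  rw [h, Matrix.det_transvection_of_ne _ _ (by simp)]
  exact isUnit_one

theorem isUnit_toMatrix_upper {n : ℕ} (i : Fin (n - 1)) (t : ℝ) :
    IsUnit ((JacobiLetter.upper i).toMatrix t) := by
  rw [← Matrix.isUnit_transpose, toMatrix_upper_transpose]
  exact isUnit_toMatrix_lower i t

theorem isUnit_toMatrix_circled {n : ℕ} (i : Fin n) {t : ℝ} (ht : t ≠ 0) :
    IsUnit ((JacobiLetter.circled i).toMatrix t) := by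
  have h : (JacobiLetter.circled i).toMatrix t =
      Matrix.diagonal (Function.update (1 : Fin n → ℝ) i t) := by
    ext x y
    by_cases hxy : x = y
    · subst hxy
      by_cases hx : x = i
      · subst hx; simp [JacobiLetter.toMatrix]
      · simp [JacobiLetter.toMatrix, hx, Ne.symm hx]
    · simp only [JacobiLetter.toMatrix, Matrix.add_apply, Matrix.one_apply_ne hxy,
        Matrix.diagonal_apply_ne _ hxy, Matrix.single_apply]
      rw [if_neg (by rintro ⟨rfl, h⟩; exact hxy h), add_zero]
  rw [h, Matrix.isUnit_iff_isUnit_det, Matrix.det_diagonal, isUnit_iff_ne_zero,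
    Finset.prod_ne_zero_iff]
  intro x _
  by_cases hx : x = i
  · subst hx; simpa using ht
  · simp [hx]

/-- One step of Neville elimination in the first column; rows other than `i + 1` do not
change. -/
theorem IsTotallyNonneg.neville_step {n : ℕ} {A : Matrix (Fin (n + 1)) (Fin (n + 1)) ℝ}
    (hA : IsTotallyNonneg A) (hu : IsUnit A) (i : Fin n) (hz : ∀ l, i.succ < l → A l 0 = 0) :
    ∃ t, 0 ≤ t ∧ ∃ A' : Matrix (Fin (n + 1)) (Fin (n + 1)) ℝ, IsTotallyNonneg A' ∧ IsUnit A' ∧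
      A = (JacobiLetter.lower (n := n + 1) i).toMatrix t * A' ∧ A' i.succ 0 = 0 ∧
      ∀ l, l ≠ i.succ → A' l = A l := by
  rcases eq_or_ne (A i.castSucc 0) 0 with h0 | h0
  · exact ⟨0, le_rfl, A, hA, hu, by rw [toMatrix_lower_mul]; simp,
      hA.eq_zero_of_eq_zero hu Fin.castSucc_lt_succ h0, fun _ _ => rfl⟩
  have hpos := lt_of_le_of_ne (hA.entry_nonneg _ _) h0.symm
  set t := A i.succ 0 / A i.castSucc 0 with ht
  have hne : i.castSucc ≠ i.succ := Fin.castSucc_lt_succ.ne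
  have hfac : A = (JacobiLetter.lower (n := n + 1) i).toMatrix t *
      A.updateRow i.succ (A i.succ + (-t) • A i.castSucc) := by
    rw [toMatrix_lower_mul]
    ext x y
    by_cases hx : x = i.succ
    · subst hx; simp [hne]
    · simp [hx]
  refine ⟨t, div_nonneg (hA.entry_nonneg _ _) hpos.le, _,
    hA.updateRow_sub (i := i.castSucc) (j := i.succ) (by simp) hz hpos, ?_, hfac, ?_, ?_⟩
  · rw [hfac] at hu
    exact ((isUnit_toMatrix_lower (n := n + 1) i t).mul_left_iff).1 hu
  · simp only [Matrix.updateRow_self, Pi.add_apply, Pi.smul_apply, smul_eq_mul]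
    field_simp
    ring
  · intro l hl
    funext y
    simp [hl]

/-! ### Products along a word -/

/-- `A` is a product `x_w(t₁, …, t_l)` with all parameters nonnegative and those at circled
letters positive. The pairs in the list `p` are the letters with their parameters. -/
def IsWordProduct {n : ℕ} (w : List (JacobiLetter n)) (A : Matrix (Fin n) (Fin n) ℝ) : Prop :=
  ∃ p : List (JacobiLetter n × ℝ), p.map Prod.fst = w ∧
    (∀ q ∈ p, 0 ≤ q.2 ∧ ∀ i, q.1 = JacobiLetter.circled i → 0 < q.2) ∧
    (p.map fun q => q.1.toMatrix q.2).prod = A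

theorem isWordProduct_nil {n : ℕ} : IsWordProduct [] (1 : Matrix (Fin n) (Fin n) ℝ) :=
  ⟨[], rfl, by simp, by simp⟩

theorem isWordProduct_singleton {n : ℕ} {a : JacobiLetter n} {t : ℝ} (ht : 0 ≤ t)
    (ha : ∀ i, a = JacobiLetter.circled i → 0 < t) : IsWordProduct [a] (a.toMatrix t) :=
  ⟨[(a, t)], rfl, by simpa using ⟨ht, ha⟩, by simp⟩

theorem isWordProduct_append_iff {n : ℕ} {u v : List (JacobiLetter n)}
    {A : Matrix (Fin n) (Fin n) ℝ} :
    IsWordProduct (u ++ v) A ↔ ∃ X Y, IsWordProduct u X ∧ IsWordProduct v Y ∧ X * Y = A := by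
  constructor
  · rintro ⟨p, hp, hpos, rfl⟩
    obtain ⟨p₁, p₂, rfl, h₁, h₂⟩ := List.map_eq_append_iff.1 hp
    refine ⟨_, _, ⟨p₁, h₁, fun q hq => hpos q (by simp [hq]), rfl⟩,
      ⟨p₂, h₂, fun q hq => hpos q (by simp [hq]), rfl⟩, by simp⟩
  · rintro ⟨_, _, ⟨p₁, rfl, h₁, rfl⟩, ⟨p₂, rfl, h₂, rfl⟩, rfl⟩
    refine ⟨p₁ ++ p₂, by simp, fun q hq => ?_, by simp⟩
    rcases List.mem_append.1 hq with h | h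
    exacts [h₁ q h, h₂ q h]

theorem IsWordProduct.mul {n : ℕ} {u v : List (JacobiLetter n)} {X Y : Matrix (Fin n) (Fin n) ℝ}
    (hX : IsWordProduct u X) (hY : IsWordProduct v Y) : IsWordProduct (u ++ v) (X * Y) :=
  isWordProduct_append_iff.2 ⟨X, Y, hX, hY, rfl⟩

/-- Two words may be interchanged if every letter of one commutes with every letter of the
other. -/
theorem IsWordProduct.append_comm {n : ℕ} {u v : List (JacobiLetter n)}
    {A : Matrix (Fin n) (Fin n) ℝ}
    (huv : ∀ a ∈ u, ∀ b ∈ v, ∀ s t : ℝ, Commute (a.toMatrix s) (b.toMatrix t))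
    (h : IsWordProduct (u ++ v) A) : IsWordProduct (v ++ u) A := by
  obtain ⟨X, Y, ⟨p, rfl, hp, rfl⟩, ⟨q, rfl, hq, rfl⟩, rfl⟩ := isWordProduct_append_iff.1 h
  have hc : Commute (p.map fun q => q.1.toMatrix q.2).prod
      (q.map fun q => q.1.toMatrix q.2).prod := by
    apply Commute.list_prod_left
    intro x hx
    apply Commute.list_prod_right
    intro y hy
    obtain ⟨a, ha, rfl⟩ := List.mem_map.1 hx
    obtain ⟨b, hb, rfl⟩ := List.mem_map.1 hy
    exact huv _ (List.mem_map_of_mem ha) _ (List.mem_map_of_mem hb) _ _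
  rw [hc.eq]
  exact IsWordProduct.mul ⟨q, rfl, hq, rfl⟩ ⟨p, rfl, hp, rfl⟩

/-- The heads of the blocks `g k :: T k` may be collected from the front of the word if each tail
commutes with the heads of the later blocks. -/
theorem IsWordProduct.interleave {n : ℕ} {ι : Type*} (g : ι → JacobiLetter n)
    (T : ι → List (JacobiLetter n)) (l : List ι)
    (hl : l.Pairwise fun j k => ∀ a ∈ T j, ∀ s t : ℝ, Commute (a.toMatrix s) ((g k).toMatrix t)) :
    ∀ {A : Matrix (Fin n) (Fin n) ℝ}, IsWordProduct (l.map g ++ l.flatMap T) A →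
      IsWordProduct (l.flatMap fun k => g k :: T k) A := by
  induction l with
  | nil => intro A h; simpa using h
  | cons j l ih =>
    intro A h
    rw [List.pairwise_cons] at hl
    have e : (j :: l).map g ++ (j :: l).flatMap T = [g j] ++ ((l.map g ++ T j) ++ l.flatMap T) := by
      simp
    rw [e, isWordProduct_append_iff] at h
    obtain ⟨X, Y, hX, hY, rfl⟩ := h
    obtain ⟨Z, W, hZ, hW, rfl⟩ := isWordProduct_append_iff.1 hY
    have hZ' := hZ.append_comm (by
      intro a ha b hb s t
      obtain ⟨k, hk, rfl⟩ := List.mem_map.1 ha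
      exact (hl.1 k hk b hb t s).symm)
    obtain ⟨P, Q, hP, hQ, rfl⟩ := isWordProduct_append_iff.1 hZ'
    have := (hX.mul hP).mul (ih hl.2 (hQ.mul hW))
    simpa [mul_assoc] using this

/-! ### Transposition and enlargement -/

/-- The letter of the transposed matrix. -/
def JacobiLetter.transpose {n : ℕ} : JacobiLetter n → JacobiLetter n
  | .upper i => .lower i
  | .circled i => .circled i
  | .lower i => .upper i

theorem JacobiLetter.toMatrix_transpose {n : ℕ} (a : JacobiLetter n) (t : ℝ) :
    a.transpose.toMatrix t = (a.toMatrix t).transpose := by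
  cases a <;> simp [JacobiLetter.transpose, JacobiLetter.toMatrix, Matrix.transpose_add]

theorem IsWordProduct.transpose {n : ℕ} {w : List (JacobiLetter n)}
    {A : Matrix (Fin n) (Fin n) ℝ} (h : IsWordProduct w A) :
    IsWordProduct (w.map JacobiLetter.transpose).reverse A.transpose := by
  obtain ⟨p, rfl, hp, rfl⟩ := h
  refine ⟨(p.map fun q => (q.1.transpose, q.2)).reverse, ?_, ?_, ?_⟩
  · simp [Function.comp_def]
  · simp only [List.mem_reverse, List.mem_map, forall_exists_index, and_imp]
    rintro _ q hq rfl
    refine ⟨(hp q hq).1, fun i hi => (hp q hq).2 i ?_⟩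
    rcases q with ⟨_ | _ | _, t⟩ <;> simp_all [JacobiLetter.transpose]
  · rw [Matrix.transpose_list_prod]
    simp [Function.comp_def, JacobiLetter.toMatrix_transpose]

/-- The block diagonal matrix with blocks `a` and `S`. -/
def consBlock {n : ℕ} (a : ℝ) (S : Matrix (Fin n) (Fin n) ℝ) :
    Matrix (Fin (n + 1)) (Fin (n + 1)) ℝ :=
  Matrix.of (Fin.cons (Fin.cons a 0) fun i => Fin.cons 0 (S i))

section consBlock
variable {n : ℕ} (a b : ℝ) (S T : Matrix (Fin n) (Fin n) ℝ) (i j : Fin n)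

@[simp] theorem consBlock_zero_zero : consBlock a S 0 0 = a := rfl
@[simp] theorem consBlock_zero_succ : consBlock a S 0 j.succ = 0 := rfl
@[simp] theorem consBlock_succ_zero : consBlock a S i.succ 0 = 0 := rfl
@[simp] theorem consBlock_succ_succ : consBlock a S i.succ j.succ = S i j := rfl

theorem consBlock_mul : consBlock a S * consBlock b T = consBlock (a * b) (S * T) := by
  ext x y
  refine Fin.cases ?_ (fun x => ?_) x <;> refine Fin.cases ?_ (fun y => ?_) y <;>
    simp [Matrix.mul_apply, Fin.sum_univ_succ]

theorem consBlock_one_one : consBlock 1 (1 : Matrix (Fin n) (Fin n) ℝ) = 1 := by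
  ext x y
  refine Fin.cases ?_ (fun x => ?_) x <;> refine Fin.cases ?_ (fun y => ?_) y <;>
    simp [Matrix.one_apply, Fin.ext_iff]

theorem det_consBlock : (consBlock a S).det = a * S.det := by
  rw [Matrix.det_succ_column_zero, Fin.sum_univ_succ, Finset.sum_eq_zero (by simp)]
  have : (consBlock a S).submatrix (0 : Fin (n + 1)).succAbove Fin.succ = S := by
    ext x y; simp
  rw [this]
  simp

end consBlock

/-- The letter with its number increased by one. -/
def JacobiLetter.shift {n : ℕ} : JacobiLetter n → JacobiLetter (n + 1)
  | .upper i => .upper ⟨i + 1, by omega⟩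
  | .circled i => .circled i.succ
  | .lower i => .lower ⟨i + 1, by omega⟩

theorem JacobiLetter.toMatrix_shift {n : ℕ} (a : JacobiLetter n) (t : ℝ) :
    a.shift.toMatrix t = consBlock 1 (a.toMatrix t) := by
  ext x y
  refine Fin.cases ?_ (fun x => ?_) x <;> refine Fin.cases ?_ (fun y => ?_) y <;> cases a <;>
    simp [JacobiLetter.toMatrix, JacobiLetter.shift, Matrix.one_apply, Matrix.single_apply,
      Fin.ext_iff]

theorem toMatrix_circled_zero {n : ℕ} (a : ℝ) :
    (JacobiLetter.circled (0 : Fin (n + 1))).toMatrix a = consBlock a 1 := by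
  ext x y
  refine Fin.cases ?_ (fun x => ?_) x <;> refine Fin.cases ?_ (fun y => ?_) y <;>
    simp [JacobiLetter.toMatrix, Matrix.one_apply, Fin.ext_iff]

theorem IsWordProduct.shift {n : ℕ} {w : List (JacobiLetter n)}
    {A : Matrix (Fin n) (Fin n) ℝ} (h : IsWordProduct w A) :
    IsWordProduct (w.map JacobiLetter.shift) (consBlock 1 A) := by
  obtain ⟨p, rfl, hp, rfl⟩ := h
  refine ⟨p.map fun q => (q.1.shift, q.2), ?_, ?_, ?_⟩
  · simp [Function.comp_def]
  · simp only [List.mem_map, forall_exists_index, and_imp]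
    rintro _ q hq rfl
    refine ⟨(hp q hq).1, fun i hi => ?_⟩
    rcases q with ⟨_ | j | _, t⟩
    · simp [JacobiLetter.shift] at hi
    · exact (hp _ hq).2 j rfl
    · simp [JacobiLetter.shift] at hi
  · clear hp
    induction p with
    | nil => simp [consBlock_one_one]
    | cons q p ih =>
      simp only [List.map_cons, List.prod_cons, ih, JacobiLetter.toMatrix_shift, consBlock_mul,
        mul_one]

/-! ### The staircase word -/

theorem filter_le_finRange {m : ℕ} (k : Fin m) :
    ((List.finRange m).filter fun i => k ≤ i) = k :: (List.finRange m).filter fun i => k < i := by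
  induction m with
  | zero => exact k.elim0
  | succ m ih =>
    rw [List.finRange_succ]
    refine Fin.cases ?_ (fun k => ?_) k
    · simp [List.filter_map, Function.comp_def]
    · simp [List.filter_map, Function.comp_def, ih k]

theorem staircaseWord_succ (m : ℕ) :
    staircaseWord (m + 1) = (staircaseWord m).map Fin.succ ++ List.finRange (m + 1) := by
  have h : ∀ k : Fin m, ((List.finRange (m + 1)).filter fun i => k.succ ≤ i) =
      ((List.finRange m).filter fun i => k ≤ i).map Fin.succ := fun k => by
    rw [List.finRange_succ]
    simp [List.filter_map, Function.comp_def]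
  have e : (List.finRange (m + 1)).reverse = ((List.finRange m).reverse.map Fin.succ) ++ [0] := by
    rw [List.finRange_succ]; simp
  rw [staircaseWord, e, List.flatMap_append, List.flatMap_map]
  simp only [h, staircaseWord, List.map_flatMap]
  simp

theorem flatMap_filter_lt_finRange (m : ℕ) :
    ((List.finRange (m + 1)).reverse.flatMap fun k => (List.finRange (m + 1)).filter (k < ·)) =
      (staircaseWord m).map Fin.succ := by
  have h : ∀ k : Fin m, ((List.finRange (m + 1)).filter fun i => k.castSucc < i) =
      ((List.finRange m).filter fun i => k ≤ i).map Fin.succ := fun k => by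
    rw [List.finRange_succ]
    simp [List.filter_map, Function.comp_def]
  have e : (List.finRange (m + 1)).reverse =
      Fin.last m :: ((List.finRange m).reverse.map Fin.castSucc) := by
    rw [List.finRange_succ_last]; simp
  rw [e, List.flatMap_cons, List.flatMap_map]
  simp only [h, staircaseWord, List.map_flatMap]
  simp [Fin.le_last]

theorem commute_toMatrix_lower {n : ℕ} {i j : Fin (n - 1)} (h : (i : ℕ) + 1 < j) (s t : ℝ) :
    Commute ((JacobiLetter.lower j).toMatrix s) ((JacobiLetter.lower i).toMatrix t) := by
  have h1 : (⟨j, by omega⟩ : Fin n) ≠ ⟨i + 1, by omega⟩ := by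
    simp only [ne_eq, Fin.mk.injEq]; omega
  have h2 : (⟨i, by omega⟩ : Fin n) ≠ ⟨j + 1, by omega⟩ := by
    simp only [ne_eq, Fin.mk.injEq]; omega
  simp only [JacobiLetter.toMatrix, commute_iff_eq, add_mul, mul_add, one_mul, mul_one,
    Matrix.single_mul_single_of_ne _ _ _ _ h1, Matrix.single_mul_single_of_ne _ _ _ _ h2]
  abel

/-- Reordering commuting letters turns the word `n, n-1, …, 1` followed by the staircase word on
`2, …, n` into the staircase word on `1, …, n`. -/
theorem IsWordProduct.staircase_lower {n : ℕ} {X : Matrix (Fin (n + 1)) (Fin (n + 1)) ℝ}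
    (h : IsWordProduct ((List.finRange n).reverse.map (JacobiLetter.lower (n := n + 1)) ++
      ((staircaseWord (n - 1)).map JacobiLetter.lower).map JacobiLetter.shift) X) :
    IsWordProduct ((staircaseWord n).map (JacobiLetter.lower (n := n + 1))) X := by
  obtain _ | m := n
  · exact h
  have e : ((staircaseWord (m + 1 - 1)).map (JacobiLetter.lower (n := m + 1))).map
      JacobiLetter.shift = (List.finRange (m + 1)).reverse.flatMap fun k =>
        ((List.finRange (m + 1)).filter (k < ·)).map (JacobiLetter.lower (n := m + 2)) := by
    rw [← List.map_flatMap, flatMap_filter_lt_finRange, List.map_map, List.map_map]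
    rfl
  rw [e] at h
  have := IsWordProduct.interleave _ _ _ ?_ h
  · simpa [staircaseWord, List.map_flatMap, filter_le_finRange] using this
  · rw [List.pairwise_reverse]
    refine (List.pairwise_lt_finRange (m + 1)).imp ?_
    intro k j hkj a ha s t
    obtain ⟨i, hi, rfl⟩ := List.mem_map.1 ha
    have hi' : j < i := by simpa using hi
    apply commute_toMatrix_lower
    have h1 : (k : ℕ) < j := hkj
    have h2 : (j : ℕ) < i := hi'
    omega

theorem staircase_upper (n : ℕ) :
    ((staircaseWord (n - 1)).map JacobiLetter.upper).map JacobiLetter.shift ++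
      (List.finRange n).map (JacobiLetter.upper (n := n + 1)) =
    (staircaseWord n).map (JacobiLetter.upper (n := n + 1)) := by
  obtain _ | m := n
  · rfl
  rw [staircaseWord_succ, List.map_append, List.map_map, List.map_map]
  rfl

/-! ### Factorization along `i_max` -/

/-- Neville elimination of the first column of a matrix whose first column vanishes below row `m`.
The letters appear in the order `m, …, 1`. -/
theorem IsTotallyNonneg.neville_column {n m : ℕ} (hm : m ≤ n) :
    ∀ {A : Matrix (Fin (n + 1)) (Fin (n + 1)) ℝ}, IsTotallyNonneg A → IsUnit A →
      (∀ l : Fin (n + 1), m < (l : ℕ) → A l 0 = 0) →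
      ∃ X A' : Matrix (Fin (n + 1)) (Fin (n + 1)) ℝ,
        IsWordProduct (((List.finRange m).map (Fin.castLE hm)).reverse.map
          (JacobiLetter.lower (n := n + 1))) X ∧
        IsTotallyNonneg A' ∧ IsUnit A' ∧ A = X * A' ∧ A' 0 = A 0 ∧ ∀ l, l ≠ 0 → A' l 0 = 0 := by
  induction m with
  | zero =>
    intro A hA hu hz
    exact ⟨1, A, isWordProduct_nil, hA, hu, by simp, rfl,
      fun l hl => hz l (Nat.pos_of_ne_zero fun h => hl (Fin.ext h))⟩
  | succ m ih =>
    intro A hA hu hz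
    obtain ⟨t, ht, B, hB, huB, hAB, hB0, hBl⟩ := hA.neville_step hu ⟨m, hm⟩ fun l hl => hz l hl
    obtain ⟨X, A', hX, hA', hu', hBX, h0, hl⟩ := ih (by omega) hB huB fun l hl => by
      rcases eq_or_ne l (Fin.succ ⟨m, hm⟩) with rfl | hne
      · exact hB0
      · rw [hBl l hne]
        refine hz l ?_
        have : (l : ℕ) ≠ m + 1 := fun h => hne (Fin.ext h)
        omega
    refine ⟨(JacobiLetter.lower (n := n + 1) ⟨m, hm⟩).toMatrix t * X, A', ?_, hA', hu', ?_,
      h0.trans (hBl 0 (Fin.succ_ne_zero _).symm), hl⟩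
    · have := (isWordProduct_singleton (a := JacobiLetter.lower (n := n + 1) ⟨m, hm⟩) ht
        (by simp)).mul hX
      convert this using 1
      rw [List.finRange_succ_last]
      simp [Function.comp_def]
      rfl
    · rw [hAB, hBX, mul_assoc]

/-- An invertible totally nonnegative matrix is a product along `i_max`, by induction on the size:
the first column and row are eliminated and the remaining block is factored. -/
theorem IsTotallyNonneg.isWordProduct_iMaxList {n : ℕ} :
    ∀ {A : Matrix (Fin n) (Fin n) ℝ}, IsTotallyNonneg A → IsUnit A →
      IsWordProduct (iMaxList n) A := by
  induction n with
  | zero =>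
    intro A _ _
    rw [Subsingleton.elim A 1]
    exact isWordProduct_nil
  | succ n ih =>
    intro A hA hu
    obtain ⟨X, B, hX, hB, huB, hAX, -, hB0⟩ := hA.neville_column le_rfl hu
      fun l hl => absurd l.isLt (by omega)
    -- Eliminating the first row of `B` does not spoil its first column: `C` and `Bᵀ` have the same
    -- first row.
    obtain ⟨Y, C, hY, hC, huC, hBY, hC0, hCl⟩ := hB.transpose.neville_column le_rfl
      (by rwa [Matrix.isUnit_transpose]) fun l hl => absurd l.isLt (by omega)
    set a := C 0 0 with ha
    set S := C.transpose.submatrix Fin.succ Fin.succ with hS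
    have hCS : C.transpose = consBlock a S := by
      ext x y
      refine Fin.cases ?_ (fun x => ?_) x <;> refine Fin.cases ?_ (fun y => ?_) y
      · rfl
      · simpa using hCl y.succ (Fin.succ_ne_zero y)
      · rw [Matrix.transpose_apply, hC0]
        exact hB0 _ (Fin.succ_ne_zero x)
      · rfl
    have hdet : a * S.det ≠ 0 := by
      rw [← det_consBlock, ← hCS, Matrix.det_transpose]
      exact ((Matrix.isUnit_iff_isUnit_det C).1 huC).ne_zero
    have hapos : 0 < a := lt_of_le_of_ne (hC.entry_nonneg 0 0) (left_ne_zero_of_mul hdet).symm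
    have hSTN : IsTotallyNonneg S :=
      hC.transpose.submatrix (Fin.strictMono_succ) (Fin.strictMono_succ)
    have hSu : IsUnit S := (Matrix.isUnit_iff_isUnit_det S).2 (right_ne_zero_of_mul hdet).isUnit
    obtain ⟨_, U, hLD, hU, hLDU⟩ := isWordProduct_append_iff.1 (ih hSTN hSu)
    obtain ⟨L, D, hL, hD, rfl⟩ := isWordProduct_append_iff.1 hLD
    have hfac : A = X * consBlock 1 L * (consBlock a 1 * consBlock 1 D) *
        (consBlock 1 U * Y.transpose) := by
      have h1 : B = C.transpose * Y.transpose := by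
        rw [← Matrix.transpose_mul, ← hBY, Matrix.transpose_transpose]
      have h2 : consBlock a S =
          consBlock 1 L * (consBlock a 1 * consBlock 1 D) * consBlock 1 U := by
        simp only [consBlock_mul, one_mul, mul_one, hLDU]
      rw [hAX, h1, hCS, h2]
      simp only [mul_assoc]
    rw [hfac]
    have hid : (List.finRange n).map (Fin.castLE le_rfl) = List.finRange n := by simp
    rw [hid] at hX hY
    have hlow := (hX.mul hL.shift).staircase_lower
    have hmid : IsWordProduct ((List.finRange (n + 1)).map JacobiLetter.circled)
        (consBlock a 1 * consBlock 1 D) := by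
      have h := (isWordProduct_singleton (a := JacobiLetter.circled (0 : Fin (n + 1))) hapos.le
        fun _ _ => hapos).mul hD.shift
      rw [toMatrix_circled_zero] at h
      rw [List.finRange_succ]
      simpa [Function.comp_def, JacobiLetter.shift] using h
    have hup : IsWordProduct ((staircaseWord n).map (JacobiLetter.upper (n := n + 1)))
        (consBlock 1 U * Y.transpose) := by
      have h := hU.shift.mul hY.transpose
      rw [← staircase_upper]
      simpa [Function.comp_def, JacobiLetter.transpose] using h
    exact (hlow.mul hmid).mul hup

/-! ### Elementary Jacobi factors -/

theorem JacobiLetter.isUnit_toMatrix {n : ℕ} (a : JacobiLetter n) {t : ℝ}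
    (ht : ∀ i, a = JacobiLetter.circled i → 0 < t) : IsUnit (a.toMatrix t) := by
  cases a with
  | upper i => exact isUnit_toMatrix_upper i t
  | circled i => exact isUnit_toMatrix_circled i (ht i rfl).ne'
  | lower i => exact isUnit_toMatrix_lower i t

theorem isElementaryJacobi_one_add_single {n : ℕ} {i j : Fin n} {t : ℝ}
    (hij : i = j ∨ (i : ℕ) + 1 = j ∨ (j : ℕ) + 1 = i) (ht : t ≠ 0)
    (hu : IsUnit (1 + Matrix.single i j t)) : IsElementaryJacobi (1 + Matrix.single i j t) := by
  refine ⟨hu, i, j, hij, by simpa using ht, fun a b hab => ?_⟩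
  rw [Matrix.add_apply, Matrix.single_apply, if_neg, add_zero]
  rintro ⟨rfl, rfl⟩
  exact hab rfl

theorem JacobiLetter.toMatrix_eq_one_or_isElementaryJacobi {n : ℕ} (a : JacobiLetter n) {t : ℝ}
    (ht : ∀ i, a = JacobiLetter.circled i → 0 < t) :
    a.toMatrix t = 1 ∨ IsElementaryJacobi (a.toMatrix t) := by
  have hu := a.isUnit_toMatrix ht
  cases a with
  | upper i =>
    rcases eq_or_ne t 0 with rfl | h
    · left; simp [JacobiLetter.toMatrix]
    · exact Or.inr (isElementaryJacobi_one_add_single (by simp) h hu)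
  | circled i =>
    rcases eq_or_ne t 1 with rfl | h
    · left; simp [JacobiLetter.toMatrix]
    · exact Or.inr (isElementaryJacobi_one_add_single (by simp) (sub_ne_zero.2 h) hu)
  | lower i =>
    rcases eq_or_ne t 0 with rfl | h
    · left; simp [JacobiLetter.toMatrix]
    · exact Or.inr (isElementaryJacobi_one_add_single (by simp) h hu)

theorem JacobiLetter.toMatrix_nonneg {n : ℕ} (a : JacobiLetter n) {t : ℝ} (ht : 0 ≤ t)
    (x y : Fin n) : 0 ≤ a.toMatrix t x y := by
  cases a <;> simp only [JacobiLetter.toMatrix, Matrix.add_apply, Matrix.one_apply,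
    Matrix.single_apply] <;> split_ifs <;> first | linarith | grind

/-- Letters with a parameter that makes their matrix the identity are dropped. -/
theorem IsWordProduct.exists_list_isElementaryJacobi {n : ℕ} {w : List (JacobiLetter n)}
    {A : Matrix (Fin n) (Fin n) ℝ} (h : IsWordProduct w A) :
    ∃ L : List (Matrix (Fin n) (Fin n) ℝ),
      (∀ M ∈ L, IsElementaryJacobi M ∧ ∀ i j, 0 ≤ M i j) ∧ A = L.prod := by
  obtain ⟨p, -, hp, rfl⟩ := h
  induction p with
  | nil => exact ⟨[], by simp, by simp⟩
  | cons q p ih =>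
    obtain ⟨L, hL, hprod⟩ := ih fun q hq => hp q (by simp [hq])
    have hq := hp q (by simp)
    rcases q.1.toMatrix_eq_one_or_isElementaryJacobi hq.2 with h1 | hJ
    · exact ⟨L, hL, by simp [h1, hprod]⟩
    · refine ⟨q.1.toMatrix q.2 :: L, ?_, by simp [hprod]⟩
      rw [List.forall_mem_cons]
      exact ⟨⟨hJ, q.1.toMatrix_nonneg hq.1⟩, hL⟩

theorem mainTheorem7 (n : ℕ) (A : Matrix (Fin n) (Fin n) ℝ) (hA : IsUnit A)
    (hTN : IsTotallyNonneg A) :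
    (∃ t : Fin (n ^ 2) → ℝ, (∀ k, 0 ≤ t k) ∧
      (∀ k i, iMax n k = JacobiLetter.circled i → 0 < t k) ∧
      A = jacobiProduct (iMax n) t) ∧
    (∃ L : List (Matrix (Fin n) (Fin n) ℝ),
      (∀ M ∈ L, IsElementaryJacobi M ∧ ∀ i j, 0 ≤ M i j) ∧ A = L.prod) := by
  have hW := hTN.isWordProduct_iMaxList hA
  refine ⟨?_, hW.exists_list_isElementaryJacobi⟩
  obtain ⟨p, hpw, hp, rfl⟩ := hW
  have hlen : p.length = n ^ 2 := by rw [← length_iMaxList n, ← hpw, List.length_map]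
  have hi : ∀ k : Fin (n ^ 2), iMax n k = (p[k]'(by omega)).1 := fun k => by
    simp [iMax, ← hpw]
  refine ⟨fun k => (p[k]'(by omega)).2, fun k => (hp _ (List.getElem_mem _)).1, fun k i h => ?_, ?_⟩
  · rw [hi] at h
    exact (hp _ (List.getElem_mem _)).2 i h
  · rw [jacobiProduct]
    congr 1
    apply List.ext_getElem
    · simp [hlen]
    · intro k h1 h2
      simp [hi]
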